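/- Let $k$ be a commutative artinian ring and let $(\mathcal C,\mathbb E,\mathfrak s)$ be a $k$-linear extriangulated category (in the sense of Nakaoka–Palu) which is Krull–Schmidt and Ext-finite, i.e. $\mathbb E(Z,A)$ is a finitely generated $k$-module for all objects $Z,A$. Assume the WIC condition: for all composable morphisms $f\colon A\to B$, $g\colon B\to Z$ in $\mathcal C$, if $g\circ f$ is an $\mathfrak s$-inflation then so is $f$, and if $g\circ f$ is an $\mathfrak s$-deflation then so is $g$. Let $D=\operatorname{Hom}_k(-,\check k)$, where $\check k$ is the minimal injective cogenerator of the category of finitely generated $k$-modules. A morphism $f\colon X\to Y$ is $\mathfrak s$-projective if $\mathbb E(f,A)=0$ for all $A\in\mathcal C$; let $\mathcal P$ be the ideal of $\mathfrak s$-projective morphisms and $\underline{\mathcal C}=\mathcal C/\mathcal P$ the stable category. An object $S$ is $\mathfrak s$-injective if $\mathbb E(A,\mathrm{Id}_S)=0$ for all $A\in\mathcal C$. Let $\mathcal C_l$ be the full subcategory of those $X\in\mathcal C$ for which the functor $D\mathbb E(-,X)\colon\underline{\mathcal C}\to k\text{-mod}$ is representable, i.e. naturally isomorphic to $\underline{\mathcal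 C}(W,-)$ for some object $W$. A morphism $\alpha\colon X\to Y$ is right $C$-determined if every $g\colon T\to Y$ such that $g\circ h$ factors through $\alpha$ for all $h\colon C\to T$ itself factors through $\alpha$. A morphism $\alpha'\colon X'\to Y$ is right minimal if every $g\in\operatorname{End}(X')$ with $\alpha'\circ g=\alpha'$ is an automorphism. An object $K$ is an intrinsic weak kernel of an $\mathfrak s$-deflation $\alpha\colon X\to Y$ if there is an $\mathfrak s$-triangle $K\to X'\xrightarrow{\alpha'}Y\dashrightarrow$ with $\alpha'$ right minimal such that $\alpha$ and $\alpha'$ factor through each other. **Proposition.** Let $K\in\mathcal C$ be an object without non-zero $\mathfrak s$-injective direct summands. Then the following statements are equivalent: 1. $K\in\mathcal C_l$. 2. $K$ is an intrinsic weak kernel of some $\mathfrak s$-deflation $\alpha\colon X\to Y$ which is right $C$-determined for some object $C$. -/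

import Mathlib

open CategoryTheory Limits

universe e w v u

/-! ### The duality `D` over a commutative artinian ring -/

/-- `ι : M → J` is an injective hull of the `k`-module `M`: `J` is injective, `ι` is a monomorphism
and its image is an essential submodule of `J`. -/
structure IsInjectiveHull (k : Type w) [CommRing k] {M J : Type w} [AddCommGroup M] [Module k M]
    [AddCommGroup J] [Module k J] (ι : M →ₗ[k] J) : Prop where
  mono : Function.Injective ι
  injective : Module.Injective k J
  essential : ∀ N : Submodule k J, N ≠ ⊥ → N ⊓ LinearMap.range ι ≠ ⊥

theorem exists_isInjectiveHull (k : Type w) [CommRing k] (M : Type w) [AddCommGroup M]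
    [Module k M] : ∃ (J : ModuleCat.{w} k) (ι : M →ₗ[k] J), IsInjectiveHull k ι := by
  classical
  obtain ⟨⟨I, hIinj, f', hf'⟩⟩ := EnoughInjectives.presentation (ModuleCat.of k M)
  let f : M →ₗ[k] I := f'.hom
  have hf : Function.Injective f := (ModuleCat.mono_iff_injective f').1 hf'
  have hI : Module.Injective k I := by
    have : Injective (ModuleCat.of k I) := hIinj
    exact Module.injective_module_of_injective_object k I
  -- a maximal essential extension of `M` inside `I`
  let S : Set (Submodule k I) := {N | LinearMap.range f ≤ N ∧
    ∀ x ∈ N, x ≠ 0 → ∃ r : k, r • x ≠ 0 ∧ r • x ∈ LinearMap.range f}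
  obtain ⟨N, hfN, hN⟩ : ∃ N, LinearMap.range f ≤ N ∧ Maximal (· ∈ S) N := by
    refine zorn_le_nonempty₀ S ?_ (LinearMap.range f) ⟨le_rfl, fun x hx h0 => ⟨1, by simpa using h0,
      by simpa using hx⟩⟩
    intro c hcS hc y hy
    refine ⟨sSup c, ⟨(hcS hy).1.trans (le_sSup hy), ?_⟩, fun z hz => le_sSup hz⟩
    intro x hx h0
    obtain ⟨z, hz, hxz⟩ := (Submodule.mem_sSup_of_directed ⟨y, hy⟩ hc.directedOn).1 hx
    exact (hcS hz).2 x hxz h0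
  -- a maximal submodule meeting `N` trivially
  obtain ⟨C, -, hC⟩ : ∃ C, ⊥ ≤ C ∧ Maximal (· ∈ {C : Submodule k I | Disjoint N C}) C := by
    refine zorn_le_nonempty₀ _ ?_ ⊥ disjoint_bot_right
    intro c hcS hc y hy
    refine ⟨sSup c, ?_, fun z hz => le_sSup hz⟩
    rw [Set.mem_ofPred_eq, Submodule.disjoint_def]
    intro x hxN hx
    obtain ⟨z, hz, hxz⟩ := (Submodule.mem_sSup_of_directed ⟨y, hy⟩ hc.directedOn).1 hx
    exact Submodule.disjoint_def.1 (hcS hz) x hxN hxz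
  have hNC : ∀ x ∈ N, x ∈ C → x = 0 := Submodule.disjoint_def.1 hC.prop
  have key : ∀ x : I, x ∉ C → ∃ r : k, ∃ n ∈ N, n ≠ 0 ∧ r • x - n ∈ C := by
    intro x hx
    have h1 : ¬ Disjoint N (C ⊔ Submodule.span k {x}) := fun h => hx
      (hC.le_of_ge h le_sup_left (Submodule.mem_sup_right (Submodule.mem_span_singleton_self x)))
    rw [Submodule.disjoint_def] at h1
    push Not at h1
    obtain ⟨n, hn, hn', hn0⟩ := h1
    obtain ⟨c, hc, z, hz, rfl⟩ := Submodule.mem_sup.1 hn'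
    obtain ⟨r, rfl⟩ := Submodule.mem_span_singleton.1 hz
    exact ⟨r, _, hn, hn0, by simpa using C.neg_mem hc⟩
  let g : N →ₗ[k] I ⧸ C := C.mkQ ∘ₗ N.subtype
  have hg : Function.Injective g := by
    rw [injective_iff_map_eq_zero]
    rintro ⟨x, hx⟩ h
    exact Subtype.ext (hNC x hx ((Submodule.Quotient.mk_eq_zero C).1 h))
  obtain ⟨h, hh⟩ := hI.out g hg N.subtype
  have hmk : ∀ n ∈ N, h (C.mkQ n) = n := fun n hn => hh ⟨n, hn⟩
  have hrange : LinearMap.range h ∈ S := by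
    refine ⟨?_, ?_⟩
    · intro y hy
      exact ⟨C.mkQ y, hmk y (hfN hy)⟩
    · rintro _ ⟨x, rfl⟩ h0
      obtain ⟨x, rfl⟩ := C.mkQ_surjective x
      have hx : x ∉ C := fun hx => h0 (by
        rw [show C.mkQ x = 0 from (Submodule.Quotient.mk_eq_zero C).2 hx, map_zero])
      obtain ⟨r, n, hn, hn0, hr⟩ := key x hx
      have e1 : r • h (C.mkQ x) = n := by
        rw [← map_smul, ← map_smul, ← hmk n hn]
        congr 1
        exact (Submodule.Quotient.eq C).2 hr
      obtain ⟨s, hs, hs'⟩ := hN.prop.2 n hn hn0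
      exact ⟨s * r, by rwa [mul_smul, e1], by rwa [mul_smul, e1]⟩
  have hle : LinearMap.range h ≤ N := hN.le_of_ge hrange (fun y hy => ⟨C.mkQ y, hmk y hy⟩)
  let ρ : I →ₗ[k] N := LinearMap.codRestrict N (h ∘ₗ C.mkQ) (fun x => hle ⟨_, rfl⟩)
  have hρ : ∀ n : N, ρ n = n := fun n => Subtype.ext (hmk n n.2)
  refine ⟨ModuleCat.of k N, LinearMap.codRestrict N f (fun x => hfN ⟨x, rfl⟩), ?_, ?_, ?_⟩
  · intro x y hxy
    exact hf (congrArg Subtype.val hxy)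
  · refine ⟨fun X Y _ _ _ _ i hi q => ?_⟩
    obtain ⟨t, ht⟩ := hI.out i hi (N.subtype ∘ₗ q)
    refine ⟨ρ ∘ₗ t, fun x => ?_⟩
    rw [LinearMap.comp_apply, ht]
    exact hρ (q x)
  · intro P hP hbot
    obtain ⟨x, hx, hx0⟩ := Submodule.exists_mem_ne_zero_of_ne_bot hP
    obtain ⟨r, hr, m, hm⟩ := hN.prop.2 x.1 x.2 (fun h => hx0 (Subtype.ext h))
    have : r • x ∈ P ⊓ LinearMap.range (LinearMap.codRestrict N f (fun x => hfN ⟨x, rfl⟩)) :=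
      ⟨P.smul_mem r hx, m, Subtype.ext hm⟩
    rw [hbot] at this
    exact hr (congrArg Subtype.val ((Submodule.mem_bot k).1 this))

/-- The minimal injective cogenerator `ǩ` of the category of finitely generated modules over the
commutative artinian ring `k`, that is, the injective hull of `k / rad k` (the quotient `k / rad k`
is the direct sum of the simple `k`-modules, each occurring once). It is unique up to
isomorphism. -/
noncomputable def minimalInjectiveCogenerator (k : Type w) [CommRing k] : ModuleCat.{w} k :=
  (exists_isInjectiveHull k (k ⧸ Ring.jacobson k)).choose

/-- The inclusion of `k / rad k` in its injective hull. -/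
noncomputable def minimalInjectiveCogeneratorι (k : Type w) [CommRing k] :
    (k ⧸ Ring.jacobson k) →ₗ[k] minimalInjectiveCogenerator k :=
  (exists_isInjectiveHull k (k ⧸ Ring.jacobson k)).choose_spec.choose

theorem isInjectiveHull_minimalInjectiveCogeneratorι (k : Type w) [CommRing k] :
    IsInjectiveHull k (minimalInjectiveCogeneratorι k) :=
  (exists_isInjectiveHull k (k ⧸ Ring.jacobson k)).choose_spec.choose_spec

/-- The dual `D M = Hom_k(M, ǩ)`. -/
abbrev MatlisDual (k : Type w) [CommRing k] (M : Type e) [AddCommGroup M] [Module k M] :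
    Type (max e w) :=
  M →ₗ[k] minimalInjectiveCogenerator k

/-! ### Extensions and their realizations -/

/-- A biadditive functor `𝔼 : Cᵒᵖ × C → Ab` together with a `k`-linear structure: it takes values
in `k`-modules, and `(c, δ, a) ↦ c^* a_* δ` is `k`-linear in each variable. -/
structure ExtBifunctor (k : Type w) [CommRing k] (C : Type u) [Category.{v} C] [Preadditive C]
    [Linear k C] where
  functor : Cᵒᵖ ⥤ C ⥤ ModuleCat.{e} k
  map_add_right : ∀ {Z A A' : C} (a a' : A ⟶ A'),
    (functor.obj (Opposite.op Z)).map (a + a') =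
      (functor.obj (Opposite.op Z)).map a + (functor.obj (Opposite.op Z)).map a'
  map_smul_right : ∀ {Z A A' : C} (r : k) (a : A ⟶ A'),
    (functor.obj (Opposite.op Z)).map (r • a) = r • (functor.obj (Opposite.op Z)).map a
  map_add_left : ∀ {Z Z' A : C} (c c' : Z' ⟶ Z),
    (functor.map (c + c').op).app A = (functor.map c.op).app A + (functor.map c'.op).app A
  map_smul_left : ∀ {Z Z' A : C} (r : k) (c : Z' ⟶ Z),
    (functor.map (r • c).op).app A = r • (functor.map c.op).app A

namespace ExtBifunctor

variable {k : Type w} [CommRing k] {C : Type u} [Category.{v} C] [Preadditive C] [Linear k C]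
  (E : ExtBifunctor.{e} k C)

/-- The `k`-module `𝔼(Z, A)` of extensions of `Z` by `A`. -/
abbrev Ext (Z A : C) : Type e := (E.functor.obj (Opposite.op Z)).obj A

/-- `a_* : 𝔼(Z, A) → 𝔼(Z, A')`. -/
def push {Z A A' : C} (a : A ⟶ A') : E.Ext Z A →ₗ[k] E.Ext Z A' :=
  ((E.functor.obj (Opposite.op Z)).map a).hom

/-- `c^* : 𝔼(Z, A) → 𝔼(Z', A)`. -/
def pull {Z Z' A : C} (c : Z' ⟶ Z) : E.Ext Z A →ₗ[k] E.Ext Z' A :=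
  ((E.functor.map c.op).app A).hom

/-- `δ ⊕ δ' ∈ 𝔼(Z ⊕ Z', A ⊕ A')`, the extension with components `(δ, 0, 0, δ')`. -/
noncomputable def sum [HasBinaryBiproducts C] {Z A Z' A' : C} (δ : E.Ext Z A) (δ' : E.Ext Z' A') :
    E.Ext (Z ⊞ Z') (A ⊞ A') :=
  E.pull biprod.fst (E.push biprod.inl δ) + E.pull biprod.snd (E.push biprod.inr δ')

end ExtBifunctor

/-- A sequence of morphisms `A ⟶ B ⟶ Z` with prescribed ends. -/
structure ExtSeq {C : Type u} [Category.{v} C] (A Z : C) where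
  mid : C
  left : A ⟶ mid
  right : mid ⟶ Z

/-- Equivalence of sequences: an isomorphism of the middle terms compatible with the identities
of the ends. -/
instance ExtSeq.setoid {C : Type u} [Category.{v} C] (A Z : C) : Setoid (ExtSeq A Z) where
  r S T := ∃ b : S.mid ≅ T.mid, S.left ≫ b.hom = T.left ∧ b.hom ≫ T.right = S.right
  iseqv :=
    { refl := fun S => ⟨Iso.refl _, by simp, by simp⟩
      symm := by
        rintro S T ⟨b, h₁, h₂⟩
        exact ⟨b.symm, by simp [← h₁], by simp [← h₂]⟩
      trans := by
        rintro S T U ⟨b, h₁, h₂⟩ ⟨b', h₁', h₂'⟩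
        exact ⟨b ≪≫ b', by simp [← h₁', ← h₁], by simp [h₂', h₂]⟩ }

/-- A `k`-linear extriangulated structure on the additive `k`-linear category `C`. -/
structure Extriangulated (k : Type w) [CommRing k] (C : Type u) [Category.{v} C] [Preadditive C]
    [Linear k C] [HasZeroObject C] [HasBinaryBiproducts C] extends ExtBifunctor.{e} k C where
  /-- The correspondence `𝔰`, from extensions to equivalence classes of sequences. -/
  s : ∀ {Z A : C}, toExtBifunctor.Ext Z A → Quotient (ExtSeq.setoid A Z)
  /-- `𝔰` is a realization. -/
  realization : ∀ {A B Z A' B' Z' : C} (δ : toExtBifunctor.Ext Z A)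
    (δ' : toExtBifunctor.Ext Z' A')
    (x : A ⟶ B) (y : B ⟶ Z) (x' : A' ⟶ B') (y' : B' ⟶ Z'),
    s δ = ⟦⟨B, x, y⟩⟧ → s δ' = ⟦⟨B', x', y'⟩⟧ →
    ∀ (a : A ⟶ A') (c : Z ⟶ Z'), toExtBifunctor.push a δ = toExtBifunctor.pull c δ' →
      ∃ b : B ⟶ B', x ≫ b = a ≫ x' ∧ y ≫ c = b ≫ y'
  /-- Split extensions are realized by the split sequences. -/
  s_zero : ∀ (Z A : C),
    s (0 : toExtBifunctor.Ext Z A) = ⟦⟨A ⊞ Z, biprod.inl, biprod.snd⟩⟧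
  /-- `𝔰(δ ⊕ δ') = 𝔰(δ) ⊕ 𝔰(δ')`. -/
  s_sum : ∀ {A B Z A' B' Z' : C} (δ : toExtBifunctor.Ext Z A) (δ' : toExtBifunctor.Ext Z' A')
    (x : A ⟶ B) (y : B ⟶ Z) (x' : A' ⟶ B') (y' : B' ⟶ Z'),
    s δ = ⟦⟨B, x, y⟩⟧ → s δ' = ⟦⟨B', x', y'⟩⟧ →
      s (toExtBifunctor.sum δ δ') = ⟦⟨B ⊞ B', biprod.map x x', biprod.map y y'⟩⟧
  /-- (ET3) -/
  et3 : ∀ {A B Z A' B' Z' : C} (δ : toExtBifunctor.Ext Z A) (δ' : toExtBifunctor.Ext Z' A')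
    (x : A ⟶ B) (y : B ⟶ Z) (x' : A' ⟶ B') (y' : B' ⟶ Z'),
    s δ = ⟦⟨B, x, y⟩⟧ → s δ' = ⟦⟨B', x', y'⟩⟧ →
    ∀ (a : A ⟶ A') (b : B ⟶ B'), x ≫ b = a ≫ x' →
      ∃ c : Z ⟶ Z', toExtBifunctor.push a δ = toExtBifunctor.pull c δ' ∧ y ≫ c = b ≫ y'
  /-- (ET3)ᵒᵖ -/
  et3_op : ∀ {A B Z A' B' Z' : C} (δ : toExtBifunctor.Ext Z A) (δ' : toExtBifunctor.Ext Z' A')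
    (x : A ⟶ B) (y : B ⟶ Z) (x' : A' ⟶ B') (y' : B' ⟶ Z'),
    s δ = ⟦⟨B, x, y⟩⟧ → s δ' = ⟦⟨B', x', y'⟩⟧ →
    ∀ (b : B ⟶ B') (c : Z ⟶ Z'), y ≫ c = b ≫ y' →
      ∃ a : A ⟶ A', toExtBifunctor.push a δ = toExtBifunctor.pull c δ' ∧ x ≫ b = a ≫ x'
  /-- (ET4) -/
  et4 : ∀ {A B Z D F : C} (δ : toExtBifunctor.Ext Z A) (ρ : toExtBifunctor.Ext F B)
    (x : A ⟶ B) (y : B ⟶ Z) (p : B ⟶ D) (q : D ⟶ F),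
    s δ = ⟦⟨B, x, y⟩⟧ → s ρ = ⟦⟨D, p, q⟩⟧ →
      ∃ (G : C) (ξ : toExtBifunctor.Ext G A) (z : A ⟶ D) (m : D ⟶ G) (i : Z ⟶ G) (t : G ⟶ F),
        s ξ = ⟦⟨D, z, m⟩⟧ ∧
        z = x ≫ p ∧ p ≫ m = y ≫ i ∧ m ≫ t = q ∧
        s (toExtBifunctor.push y ρ) = ⟦⟨G, i, t⟩⟧ ∧
        toExtBifunctor.pull i ξ = δ ∧
        toExtBifunctor.push x ξ = toExtBifunctor.pull t ρ
  /-- (ET4)ᵒᵖ -/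
  et4_op : ∀ {A B Z D F : C} (δ : toExtBifunctor.Ext A Z) (ρ : toExtBifunctor.Ext B F)
    (y : Z ⟶ B) (x : B ⟶ A) (q : F ⟶ D) (p : D ⟶ B),
    s δ = ⟦⟨B, y, x⟩⟧ → s ρ = ⟦⟨D, q, p⟩⟧ →
      ∃ (G : C) (ξ : toExtBifunctor.Ext A G) (m : G ⟶ D) (z : D ⟶ A) (t : F ⟶ G) (i : G ⟶ Z),
        s ξ = ⟦⟨D, m, z⟩⟧ ∧
        z = p ≫ x ∧ m ≫ p = i ≫ y ∧ t ≫ m = q ∧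
        s (toExtBifunctor.pull y ρ) = ⟦⟨G, t, i⟩⟧ ∧
        toExtBifunctor.push i ξ = δ ∧
        toExtBifunctor.pull x ξ = toExtBifunctor.push t ρ

/-! ### Morphisms determined by objects -/

section Morphisms

variable {C : Type u} [Category.{v} C]

/-- `g` factors through `f`, for `g` and `f` with the same target. -/
def FactorsThrough {T X Y : C} (g : T ⟶ Y) (f : X ⟶ Y) : Prop :=
  ∃ h : T ⟶ X, h ≫ f = g

/-- `f` is right `D`-determined. -/
def IsRightDetermined (D : C) {X Y : C} (f : X ⟶ Y) : Prop :=
  ∀ (T : C) (g : T ⟶ Y), (∀ h : D ⟶ T, FactorsThrough (h ≫ g) f) → FactorsThrough g f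

/-- `f` is right minimal: every endomorphism `g` of its source with `f ∘ g = f` is an
automorphism. -/
def IsRightMinimal {X Y : C} (f : X ⟶ Y) : Prop :=
  ∀ g : X ⟶ X, g ≫ f = f → IsIso g

/-- `f'` is a right minimal version of `f`: it is right minimal, and `f` and `f'` are right
equivalent, that is, factor through each other. -/
def IsRightMinimalVersion {X' X Y : C} (f' : X' ⟶ Y) (f : X ⟶ Y) : Prop :=
  IsRightMinimal f' ∧ FactorsThrough f f' ∧ FactorsThrough f' f

end Morphisms

/-- A Krull-Schmidt category: every object is a finite direct sum of objects with local
endomorphism rings. -/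
def IsKrullSchmidt (C : Type u) [Category.{v} C] [Preadditive C] : Prop :=
  ∀ X : C, ∃ (n : ℕ) (f : Fin n → C) (b : Bicone f), Nonempty b.IsBilimit ∧ Nonempty (X ≅ b.pt) ∧
    ∀ i, IsLocalRing (End (f i))

/-! ### Notions relative to an extriangulated structure -/

namespace Extriangulated

variable {k : Type w} [CommRing k] {C : Type u} [Category.{v} C] [Preadditive C] [Linear k C]
  [HasZeroObject C] [HasBinaryBiproducts C] (E : Extriangulated.{e} k C)

/-- `A ⟶ B ⟶ Z` realizes `δ`, that is, these data form an `𝔰`-triangle. -/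
def Realizes {A B Z : C} (x : A ⟶ B) (y : B ⟶ Z) (δ : E.Ext Z A) : Prop :=
  E.s δ = ⟦⟨B, x, y⟩⟧

/-- `𝔰`-inflations. -/
def IsInflation {A B : C} (x : A ⟶ B) : Prop :=
  ∃ (Z : C) (y : B ⟶ Z) (δ : E.Ext Z A), E.Realizes x y δ

/-- `𝔰`-deflations. -/
def IsDeflation {B Z : C} (y : B ⟶ Z) : Prop :=
  ∃ (A : C) (x : A ⟶ B) (δ : E.Ext Z A), E.Realizes x y δ

/-- `C` is Ext-finite: all the `k`-modules `𝔼(Z, A)` are finitely generated. -/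
def IsExtFinite : Prop :=
  ∀ Z A : C, Module.Finite k (E.Ext Z A)

/-- The WIC condition. -/
def WIC : Prop :=
  (∀ {A B Z : C} (f : A ⟶ B) (g : B ⟶ Z), E.IsInflation (f ≫ g) → E.IsInflation f) ∧
  (∀ {A B Z : C} (f : A ⟶ B) (g : B ⟶ Z), E.IsDeflation (f ≫ g) → E.IsDeflation g)

/-- An `𝔰`-injective object: its identity is an `𝔰`-injective morphism. -/
def IsInjectiveObj (X : C) : Prop :=
  ∀ (Z : C) (δ : E.Ext Z X), E.push (𝟙 X) δ = 0

/-- `X` has no non-zero `𝔰`-injective direct summands. -/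
def HasNoInjectiveSummand (X : C) : Prop :=
  ∀ S S' : C, Nonempty (X ≅ S ⊞ S') → E.IsInjectiveObj S → IsZero S

/-- The submodule `𝒫(X, Y)` of `𝔰`-projective morphisms `f : X ⟶ Y`, those with `𝔼(f, A) = 0`
for every object `A`. -/
def projMorphisms (X Y : C) : Submodule k (X ⟶ Y) where
  carrier := {f | ∀ (A : C) (δ : E.Ext Y A), E.pull f δ = 0}
  add_mem' := by
    intro f g hf hg A δ
    have h : E.pull (f + g) δ = E.pull f δ + E.pull g δ := by
      simp only [ExtBifunctor.pull, E.map_add_left, ModuleCat.hom_add, LinearMap.add_apply]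
    rw [h, hf A δ, hg A δ, add_zero]
  zero_mem' := by
    intro A δ
    have h : E.pull ((0 : k) • (0 : X ⟶ Y)) δ = (0 : k) • E.pull (0 : X ⟶ Y) δ := by
      simp only [ExtBifunctor.pull, E.map_smul_left, ModuleCat.hom_smul, LinearMap.smul_apply]
    simpa only [zero_smul] using h
  smul_mem' := by
    intro r f hf A δ
    have h : E.pull (r • f) δ = r • E.pull f δ := by
      simp only [ExtBifunctor.pull, E.map_smul_left, ModuleCat.hom_smul, LinearMap.smul_apply]
    rw [h, hf A δ, smul_zero]

/-- The `k`-module of morphisms from `X` to `Y` in the stable category `C / 𝒫`. -/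
abbrev StableHom (X Y : C) : Type v := (X ⟶ Y) ⧸ E.projMorphisms X Y

/-- Composition with a morphism `f : M ⟶ N` of `C` on morphisms of the stable category. -/
def stableComp (W : C) {M N : C} (f : M ⟶ N) : E.StableHom W M →ₗ[k] E.StableHom W N :=
  (E.projMorphisms W M).mapQ (E.projMorphisms W N) (Linear.rightComp k W f) (by
    intro g hg A δ
    have h : E.pull (g ≫ f) δ = E.pull g (E.pull f δ) := by
      simp [ExtBifunctor.pull]
    exact h.trans (hg A _))

/-- The object `X` lies in `C_l`: the functor `D 𝔼(-, X)` from the stable category to `k`-modules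
is representable, that is, there are an object `W` and `k`-linear isomorphisms
`(C / 𝒫)(W, M) ≅ D 𝔼(M, X)` natural in `M`. -/
def MemCl (X : C) : Prop :=
  ∃ (W : C) (φ : ∀ M : C, E.StableHom W M ≃ₗ[k] MatlisDual k (E.Ext M X)),
    ∀ {M N : C} (f : M ⟶ N) (g : E.StableHom W M),
      φ N (E.stableComp W f g) = φ M g ∘ₗ E.pull f

/-- `K` is an intrinsic weak kernel of the `𝔰`-deflation `f`: there is an `𝔰`-triangle
`K ⟶ X' ⟶ Y` whose second morphism is a right minimal version of `f`. -/
def IsIntrinsicWeakKernel (K : C) {X Y : C} (f : X ⟶ Y) : Prop :=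
  E.IsDeflation f ∧ ∃ (X' : C) (f' : X' ⟶ Y), IsRightMinimalVersion f' f ∧
    ∃ (i : K ⟶ X') (δ : E.Ext Y K), E.Realizes i f' δ

end Extriangulated

/-! ### Matlis duality over a commutative artinian ring -/

namespace MatlisDual

variable {k : Type w} [CommRing k]

/-! An `𝔰`-triangle `K ⟶ X ⟶ Y` with class `δ` is exact in the sense that `t` factors through the
deflation iff `t^* δ = 0`. Right determination thus becomes a statement about extensions: `δ` is
determined by `D` if the vanishing of `g^* δ` can be tested after composing with morphisms from `D`.

Suppose `W` represents `D 𝔼(-, K)`. By Yoneda and faithfulness of the duality, morphisms from `W`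
detect non-zero extensions by `K`, so every deflation with kernel `K` is right `W`-determined. A
right minimal one is obtained by adding up non-zero extensions of the indecomposable summands of
`K`: every endomorphism fixing the sum is invertible
(`HasNoInjectiveSummand.exists_stabilizer_isIso`, `Realizes.isRightMinimal`).

Conversely, given a right minimal determined deflation with kernel `K`, minimality provides a
non-zero determined extension of each indecomposable summand `K'`
(`Realizes.exists_isDeterminedExt_retract`). Since `𝔼(D, K')` is artinian, a minimality argument
replaces it by some `ρ` generating a simple functor, and `ρ` may be moved to an object `W` with
local endomorphism ring. Such a `ρ` is almost split, and a functional `γ` with `γ ρ ≠ 0` makes the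
pairing `(f, η) ↦ γ (f^* η)` nondegenerate on both sides (`IsSimpleExt.isDualizing`). A length count
upgrades nondegeneracy to representability (`MatlisDual.eq_top_of_separatesPoints`), and dualizing
functionals add up over the summands of `K`. -/

theorem injective_ι : Function.Injective (minimalInjectiveCogeneratorι k) :=
  (isInjectiveHull_minimalInjectiveCogeneratorι k).mono

/-- `Module.Injective` only speaks of modules in one universe; the Baer form extends maps between
modules of any universe, as needed for the values of `𝔼`. -/
theorem baer : Module.Baer k (minimalInjectiveCogenerator k) :=
  Module.Baer.of_injective (isInjectiveHull_minimalInjectiveCogeneratorι k).injective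

theorem restrict_surjective {M : Type*} {N : Type*} [AddCommGroup M] [Module k M] [AddCommGroup N]
    [Module k N] (f : M →ₗ[k] N) (hf : Function.Injective f) :
    Function.Surjective (LinearMap.lcomp k (minimalInjectiveCogenerator k) f) := fun g =>
  let ⟨h, hh⟩ := baer.extension_property f hf g
  ⟨h, hh⟩

/-- There are finitely many maximal ideals, so by prime avoidance some `x` lies in all of them
except `m`. Its class spans a copy of `k / m` in `k / rad k`. -/
theorem exists_notMem_jacobson [IsArtinianRing k] (m : Ideal k) [hm : m.IsMaximal] :
    ∃ x : k, x ∉ Ring.jacobson k ∧ ∀ z ∈ m, z * x ∈ Ring.jacobson k := by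
  classical
  let s : Finset (Ideal k) := (IsArtinianRing.setOfPred_isMaximal_finite k).toFinset.erase m
  have hs : ¬ s.inf id ≤ m := by
    rw [Ideal.IsPrime.inf_le' hm.isPrime]
    rintro ⟨n, hn, hnm⟩
    have hn' : n ≠ m ∧ n.IsMaximal := by simpa [s] using hn
    exact hn'.1 (hn'.2.eq_of_le hm.ne_top hnm)
  obtain ⟨x, hx, hxm⟩ := SetLike.not_le_iff_exists.1 hs
  have hmem : ∀ y : k, y ∈ Ring.jacobson k ↔ ∀ n : Ideal k, n.IsMaximal → y ∈ n := fun y => by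
    rw [Ring.jacobson_eq_sInf_isMaximal]
    simp [Submodule.mem_sInf]
  refine ⟨x, fun h => hxm ((hmem x).1 h m hm), fun z hz => (hmem _).2 fun n hn => ?_⟩
  by_cases hnm : n = m
  · exact hnm ▸ m.mul_mem_right x hz
  · refine n.mul_mem_left z (Finset.inf_le (f := id) (?_ : n ∈ s) hx)
    simpa [s] using ⟨hnm, hn⟩

/-- The annihilator of `η` lies in a maximal ideal `m`, so `η` can be sent to a generator of the
copy of `k / m` in the cogenerator; injectivity extends this map from `k η` to `M`. -/
theorem exists_apply_ne_zero [IsArtinianRing k] {M : Type e} [AddCommGroup M] [Module k M]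
    {η : M} (hη : η ≠ 0) : ∃ γ : MatlisDual k M, γ η ≠ 0 := by
  let t := LinearMap.toSpanSingleton k M η
  have ht : LinearMap.ker t ≠ ⊤ := fun h => hη (by
    have : (1 : k) ∈ LinearMap.ker t := h ▸ Submodule.mem_top
    simpa [t] using this)
  obtain ⟨m, hm, hle⟩ := Ideal.exists_le_maximal (LinearMap.ker t) ht
  obtain ⟨x, hx, hmx⟩ := exists_notMem_jacobson m
  let y := minimalInjectiveCogeneratorι k (Submodule.Quotient.mk x)
  have hy : y ≠ 0 := fun h => hx ((Submodule.Quotient.mk_eq_zero _).1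
    (injective_ι (h.trans (map_zero _).symm)))
  have hker : LinearMap.ker t ≤
      LinearMap.ker (LinearMap.toSpanSingleton k (minimalInjectiveCogenerator k) y) := by
    intro z hz
    have h0 : (Submodule.Quotient.mk (z * x) : k ⧸ Ring.jacobson k) = 0 :=
      (Submodule.Quotient.mk_eq_zero _).2 (hmx z (hle hz))
    have : z • y = minimalInjectiveCogeneratorι k (Submodule.Quotient.mk (z * x)) := by
      rw [← smul_eq_mul, Submodule.Quotient.mk_smul, map_smul]
    rw [LinearMap.mem_ker, LinearMap.toSpanSingleton_apply, this, h0, map_zero]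
  obtain ⟨γ, hγ⟩ := baer.extension_property ((LinearMap.ker t).liftQ t le_rfl)
    (LinearMap.ker_eq_bot.1 (Submodule.ker_liftQ_eq_bot _ _ _ le_rfl))
    ((LinearMap.ker t).liftQ _ hker)
  refine ⟨γ, ?_⟩
  have := LinearMap.congr_fun hγ (Submodule.Quotient.mk 1)
  simp only [LinearMap.comp_apply, Submodule.liftQ_apply, LinearMap.toSpanSingleton_apply,
    one_smul, t] at this
  rwa [this]

/-- By essentiality, functionals on a simple module take values in the image of `k / rad k`. As `rad
k` is a radical ideal, any non-zero functional then generates all the others. -/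
theorem length_le_one_of_isSimpleModule (S : Type e) [AddCommGroup S] [Module k S]
    [IsSimpleModule k S] : Module.length k (MatlisDual k S) ≤ 1 := by
  have := IsSimpleModule.nontrivial k S
  obtain ⟨s, hs⟩ := exists_ne (0 : S)
  have hgen : ∀ x : S, x ≠ 0 → ∀ y : S, ∃ c : k, c • x = y := fun x hx y =>
    IsSimpleModule.toSpanSingleton_surjective k hx y
  have hval : ∀ u : MatlisDual k S, ∃ x : k,
      u s = minimalInjectiveCogeneratorι k (Submodule.Quotient.mk x) := by
    intro u
    by_cases hu : u s = 0
    · exact ⟨0, by rw [hu, Submodule.Quotient.mk_zero, map_zero]⟩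
    have h1 := (isInjectiveHull_minimalInjectiveCogeneratorι k).essential
      (Submodule.span k {u s}) (by simpa using hu)
    obtain ⟨_, ⟨hz, ⟨x, rfl⟩⟩, hz0⟩ := Submodule.exists_mem_ne_zero_of_ne_bot h1
    obtain ⟨r, hr⟩ := Submodule.mem_span_singleton.1 hz
    obtain ⟨x, rfl⟩ := Submodule.Quotient.mk_surjective _ x
    have hrs : r • s ≠ 0 := fun h => hz0 (by rw [← hr, ← map_smul, h, map_zero])
    obtain ⟨c, hc⟩ := hgen _ hrs s
    refine ⟨c • x, ?_⟩
    rw [Submodule.Quotient.mk_smul, map_smul, ← hr, ← map_smul, ← map_smul, hc]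
  have hann : ∀ (u : MatlisDual k S) (x z : k), z • s = 0 →
      u s = minimalInjectiveCogeneratorι k (Submodule.Quotient.mk x) →
        z * x ∈ Ring.jacobson k := by
    intro u x z hz hx
    rw [← smul_eq_mul, ← Submodule.Quotient.mk_eq_zero, Submodule.Quotient.mk_smul]
    apply injective_ι
    rw [map_smul, ← hx, ← map_smul, hz, map_zero, map_zero]
  have key : ∀ u v : MatlisDual k S, u ≠ 0 → ∃ c : k, c • u = v := by
    intro u v hu
    obtain ⟨x, hx⟩ := hval u
    obtain ⟨y, hy⟩ := hval v
    have hxJ : x ∉ Ring.jacobson k := fun h => hu (LinearMap.ext fun t => by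
      obtain ⟨c, rfl⟩ := hgen s hs t
      rw [map_smul, hx, (Submodule.Quotient.mk_eq_zero _).2 h, map_zero, smul_zero,
        LinearMap.zero_apply])
    -- If `x` killed `s`, it would kill `u s`, the class of `x` itself, giving `x ^ 2 ∈ rad k`.
    have hxs : x • s ≠ 0 := fun h => hxJ (by
      have h2 : x ^ 2 ∈ Ring.jacobson k := by
        rw [sq]
        exact hann u x x h hx
      rw [← Ideal.jacobson_bot] at h2 ⊢
      exact Ideal.isRadical_jacobson _ ⟨2, h2⟩)
    obtain ⟨c, hc⟩ := hgen _ hxs s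
    refine ⟨y * c, LinearMap.ext fun t => ?_⟩
    obtain ⟨d, rfl⟩ := hgen s hs t
    rw [LinearMap.smul_apply, map_smul, map_smul, hx, hy, smul_comm]
    congr 1
    rw [← map_smul, ← Submodule.Quotient.mk_smul]
    congr 1
    rw [Submodule.Quotient.eq, smul_eq_mul,
      show y * c * x - y = (c * x - 1) * y by ring]
    exact hann v y _ (by rw [sub_smul, mul_smul, hc, one_smul, sub_self]) hy
  by_cases hn : Nontrivial (MatlisDual k S)
  · have : IsSimpleModule k (MatlisDual k S) :=
      isSimpleModule_iff_toSpanSingleton_surjective.2 ⟨hn, fun u hu v => key u v hu⟩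
    exact (Module.length_eq_one k _).le
  · have := not_nontrivial_iff_subsingleton.1 hn
    rw [Module.length_eq_zero]
    exact zero_le_one

/-- Induction along a composition series: the dual of `0 → N → M → M / N → 0` is exact, and the dual
of the simple quotient has length at most one. -/
theorem length_le {N : Type e} [AddCommGroup N] [Module k N] (h : IsFiniteLength k N) :
    Module.length k (MatlisDual k N) ≤ Module.length k N := by
  induction h with
  | of_subsingleton =>
    rw [Module.length_eq_zero]
    exact zero_le
  | @of_simple_quotient M _ _ N _ _ ih =>
    let f := LinearMap.lcomp k (minimalInjectiveCogenerator k) N.mkQ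
    let g := LinearMap.lcomp k (minimalInjectiveCogenerator k) N.subtype
    have hf : Function.Injective f := fun a b h => LinearMap.ext fun x => by
      obtain ⟨x, rfl⟩ := N.mkQ_surjective x
      exact LinearMap.congr_fun h x
    have hfg : Function.Exact f g := by
      intro u
      constructor
      · intro hu
        exact ⟨N.liftQ u fun x hx => LinearMap.congr_fun hu ⟨x, hx⟩, LinearMap.ext fun x => rfl⟩
      · rintro ⟨a, rfl⟩
        refine LinearMap.ext fun x => ?_
        change a (N.mkQ x) = 0
        rw [show N.mkQ x = 0 from (Submodule.Quotient.mk_eq_zero N).2 x.2, map_zero]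
    rw [Module.length_eq_add_of_exact f g hf
      (restrict_surjective _ (Submodule.subtype_injective N)) hfg,
      Module.length_eq_add_of_exact N.subtype N.mkQ (Submodule.subtype_injective N)
        N.mkQ_surjective (LinearMap.exact_subtype_mkQ N), add_comm]
    refine add_le_add ih ?_
    rw [Module.length_eq_one k (M ⧸ N)]
    exact length_le_one_of_isSimpleModule _

/-- A submodule of the dual of a finitely generated module which separates points is everything. -/
theorem eq_top_of_separatesPoints [IsArtinianRing k] {M : Type e} [AddCommGroup M] [Module k M]
    [Module.Finite k M] (U : Submodule k (MatlisDual k M))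
    (hU : ∀ x : M, (∀ u ∈ U, u x = 0) → x = 0) : U = ⊤ := by
  have hM : IsFiniteLength k M :=
    isFiniteLength_iff_isNoetherian_isArtinian.2 ⟨inferInstance, inferInstance⟩
  have hDM : IsFiniteLength k (MatlisDual k M) := by
    rw [← Module.length_ne_top_iff]
    exact ((length_le hM).trans_lt (Module.length_ne_top_iff.2 hM).lt_top).ne
  have hlU : IsFiniteLength k U := hDM.of_injective (Submodule.subtype_injective U)
  obtain ⟨_, _⟩ := isFiniteLength_iff_isNoetherian_isArtinian.1 hDM
  let ev : M →ₗ[k] MatlisDual k U := (LinearMap.id.domRestrict U).flip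
  have hev : Function.Injective ev := by
    rw [injective_iff_map_eq_zero]
    intro x hx
    exact hU x fun u hu => LinearMap.congr_fun hx ⟨u, hu⟩
  by_contra hne
  have h1 := Submodule.length_lt hne
  -- Evaluation embeds `M` into the dual of `U`, so `ℓ(D M) ≤ ℓ(M) ≤ ℓ(D U) ≤ ℓ(U)`, against `ℓ(U) <
  -- ℓ(D M)` for a proper submodule.
  exact absurd ((length_le hM).trans
    ((Module.length_le_of_injective ev hev).trans (length_le hlU))) h1.not_ge

end MatlisDual

/-! ### Properties of objects of a Krull-Schmidt category -/

section KrullSchmidt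

variable {C : Type u} [Category.{v} C] [Preadditive C] [HasZeroObject C] [HasBinaryBiproducts C]

/-- A property of objects closed under isomorphisms, zero objects and binary direct sums holds for
a finite direct sum of objects which have it. -/
theorem CategoryTheory.Limits.Bicone.IsBilimit.induction_biprod (P : C → Prop)
    (hiso : ∀ {X Y : C}, (X ≅ Y) → P X → P Y) (hzero : ∀ X : C, IsZero X → P X)
    (hsum : ∀ X Y : C, P X → P Y → P (X ⊞ Y)) {n : ℕ} {f : Fin n → C} {b : Bicone f}
    (hb : b.IsBilimit) (hf : ∀ i, P (f i)) : P b.pt := by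
  have : HasFiniteProducts C := hasFiniteProducts_of_has_binary_and_terminal
  have : HasFiniteBiproducts C := HasFiniteBiproducts.of_hasFiniteProducts
  refine hiso (biproduct.uniqueUpToIso f hb).symm ?_
  clear hb b
  induction n with
  | zero =>
    refine hzero _ ((IsZero.iff_id_eq_zero _).2 ?_)
    exact biproduct.hom_ext _ _ fun j => j.elim0
  | succ n ih =>
    refine hiso ?_ (hsum _ _ (hf 0) (ih (f := fun i => f i.succ) fun i => hf _))
    have hne : ∀ i : Fin n, i.succ ≠ 0 := fun i => Fin.succ_ne_zero i
    refine
      { hom := biprod.desc (biproduct.ι f 0) (biproduct.desc fun i => biproduct.ι f i.succ)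
        inv := biprod.lift (biproduct.π f 0) (biproduct.lift fun i => biproduct.π f i.succ)
        hom_inv_id := ?_
        inv_hom_id := ?_ }
    · apply biprod.hom_ext' <;> apply biprod.hom_ext
      · simp
      · apply biproduct.hom_ext
        intro j
        simp [biproduct.ι_π_ne f (hne j).symm]
      · apply biproduct.hom_ext'
        intro j
        simp [biproduct.ι_π_ne f (hne j)]
      · apply biproduct.hom_ext'
        intro i
        apply biproduct.hom_ext
        intro j
        by_cases hij : i = j
        · subst hij
          simp
        · simp [biproduct.ι_π_ne f fun h => hij (Fin.succ_injective _ h), biproduct.ι_π_ne _ hij]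
    · rw [biprod.lift_desc, biproduct.lift_desc, ← biproduct.total, Fin.sum_univ_succ]

/-- In a Krull-Schmidt category it suffices to check a property closed under isomorphisms, zero
objects and binary direct sums on objects with local endomorphism rings. -/
theorem IsKrullSchmidt.induction (hKS : IsKrullSchmidt C) (P : C → Prop)
    (hiso : ∀ {X Y : C}, (X ≅ Y) → P X → P Y) (hzero : ∀ X : C, IsZero X → P X)
    (hsum : ∀ X Y : C, P X → P Y → P (X ⊞ Y)) (hloc : ∀ X : C, IsLocalRing (End X) → P X)
    (X : C) : P X := by
  obtain ⟨n, f, b, ⟨hb⟩, ⟨i⟩, h⟩ := hKS X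
  exact hiso i.symm (hb.induction_biprod P hiso hzero hsum fun j => hloc _ (h j))

end KrullSchmidt

/-! ### Invertible endomorphisms: local rings and block matrices -/

section LocalEnd

variable {C : Type u} [Category.{v} C] [Preadditive C]

theorem isIso_or_isIso_id_sub {X : C} (h : IsLocalRing (End X)) (a : X ⟶ X) :
    IsIso a ∨ IsIso (𝟙 X - a) :=
  (h.isUnit_or_isUnit_of_add_one (a := (a : End X)) (b := 𝟙 X - a)
    (add_sub_cancel a (𝟙 X))).imp
    (isUnit_iff_isIso a).1 (isUnit_iff_isIso (𝟙 X - a : End X)).1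

theorem id_ne_zero_of_isLocalRing_end {X : C} (h : IsLocalRing (End X)) : 𝟙 X ≠ 0 :=
  one_ne_zero (α := End X)

/-- Gaussian elimination diagonalizes the matrix, leaving `f₁₁` and its Schur complement. -/
theorem isIso_biprod_ofComponents_of_schur [HasBinaryBiproducts C] {X₁ X₂ : C}
    (f₁₁ : X₁ ⟶ X₁) (f₁₂ : X₁ ⟶ X₂) (f₂₁ : X₂ ⟶ X₁) (f₂₂ : X₂ ⟶ X₂) [IsIso f₁₁]
    (hs : IsIso (f₂₂ - f₂₁ ≫ inv f₁₁ ≫ f₁₂)) : IsIso (Biprod.ofComponents f₁₁ f₁₂ f₂₁ f₂₂) := by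
  obtain ⟨L, R, g, hg, h⟩ : ∃ (L : X₁ ⊞ X₂ ≅ X₁ ⊞ X₂) (R : X₁ ⊞ X₂ ≅ X₁ ⊞ X₂) (g : X₂ ⟶ X₂),
      IsIso g ∧ L.hom ≫ Biprod.ofComponents f₁₁ f₁₂ f₂₁ f₂₂ ≫ R.hom = biprod.map f₁₁ g :=
    ⟨_, _, _, hs, (Biprod.gaussian' f₁₁ f₁₂ f₂₁ f₂₂).2.2.2⟩
  have h2 : IsIso (L.hom ≫ Biprod.ofComponents f₁₁ f₁₂ f₂₁ f₂₂ ≫ R.hom) := by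
    rw [h]
    exact (biprod.mapIso (asIso _) (asIso g)).isIso_hom
  have h3 : Biprod.ofComponents f₁₁ f₁₂ f₂₁ f₂₂ =
      L.inv ≫ (L.hom ≫ Biprod.ofComponents f₁₁ f₁₂ f₂₁ f₂₂ ≫ R.hom) ≫ R.inv := by simp
  rw [h3]
  infer_instance

end LocalEnd

/-! ### Calculus of extensions -/

namespace ExtBifunctor

variable {k : Type w} [CommRing k] {C : Type u} [Category.{v} C] [Preadditive C] [Linear k C]
  (E : ExtBifunctor.{e} k C)

@[simp]
theorem push_push {Z A A' A'' : C} (a : A ⟶ A') (a' : A' ⟶ A'') (δ : E.Ext Z A) :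
    E.push a' (E.push a δ) = E.push (a ≫ a') δ := by
  simp [push]

@[simp]
theorem pull_pull {Z Z' Z'' A : C} (c : Z' ⟶ Z) (c' : Z'' ⟶ Z') (δ : E.Ext Z A) :
    E.pull c' (E.pull c δ) = E.pull (c' ≫ c) δ := by
  simp [pull]

@[simp]
theorem push_id {Z A : C} (δ : E.Ext Z A) : E.push (𝟙 A) δ = δ := by
  simp [push]

@[simp]
theorem pull_id {Z A : C} (δ : E.Ext Z A) : E.pull (𝟙 Z) δ = δ := by
  simp [pull]

theorem pull_push {Z Z' A A' : C} (c : Z' ⟶ Z) (a : A ⟶ A') (δ : E.Ext Z A) :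
    E.pull c (E.push a δ) = E.push a (E.pull c δ) := by
  have h := (E.functor.map c.op).naturality a
  exact congrArg (fun t => t.hom δ) h

theorem push_add {Z A A' : C} (a a' : A ⟶ A') (δ : E.Ext Z A) :
    E.push (a + a') δ = E.push a δ + E.push a' δ := by
  simp [push, E.map_add_right]

theorem pull_add {Z Z' A : C} (c c' : Z' ⟶ Z) (δ : E.Ext Z A) :
    E.pull (c + c') δ = E.pull c δ + E.pull c' δ := by
  simp only [pull, E.map_add_left, ModuleCat.hom_add, LinearMap.add_apply]

theorem pull_smul {Z Z' A : C} (r : k) (c : Z' ⟶ Z) (δ : E.Ext Z A) :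
    E.pull (r • c) δ = r • E.pull c δ := by
  simp only [pull, E.map_smul_left, ModuleCat.hom_smul, LinearMap.smul_apply]

/-- The map `a ↦ a_* δ`, as an additive homomorphism. -/
def pushHom {Z A : C} (A' : C) (δ : E.Ext Z A) : (A ⟶ A') →+ E.Ext Z A' where
  toFun a := E.push a δ
  map_zero' := by
    have h := E.push_add (0 : A ⟶ A') 0 δ
    rwa [add_zero, left_eq_add] at h
  map_add' a a' := E.push_add a a' δ

/-- The map `c ↦ c^* δ`, as a `k`-linear map. -/
def pullHom {Z A : C} (Z' : C) (δ : E.Ext Z A) : (Z' ⟶ Z) →ₗ[k] E.Ext Z' A where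
  toFun c := E.pull c δ
  map_add' c c' := E.pull_add c c' δ
  map_smul' r c := E.pull_smul r c δ

@[simp]
theorem push_zero_left {Z A A' : C} (δ : E.Ext Z A) : E.push (0 : A ⟶ A') δ = 0 :=
  (E.pushHom A' δ).map_zero

@[simp]
theorem pull_zero_left {Z Z' A : C} (δ : E.Ext Z A) : E.pull (0 : Z' ⟶ Z) δ = 0 :=
  (E.pullHom Z' δ).map_zero

theorem push_sub {Z A A' : C} (a a' : A ⟶ A') (δ : E.Ext Z A) :
    E.push (a - a') δ = E.push a δ - E.push a' δ :=
  (E.pushHom A' δ).map_sub a a'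

theorem pull_sub {Z Z' A : C} (c c' : Z' ⟶ Z) (δ : E.Ext Z A) :
    E.pull (c - c') δ = E.pull c δ - E.pull c' δ :=
  (E.pullHom Z' δ).map_sub c c'

theorem eq_zero_of_push_eq_zero {Z A A' : C} (a : A ⟶ A') [IsIso a] {δ : E.Ext Z A}
    (h : E.push a δ = 0) : δ = 0 := by
  have h2 := congrArg (E.push (inv a)) h
  simpa using h2

theorem eq_zero_of_pull_eq_zero {Z Z' A : C} (c : Z' ⟶ Z) [IsIso c] {δ : E.Ext Z A}
    (h : E.pull c δ = 0) : δ = 0 := by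
  have h2 := congrArg (E.pull (inv c)) h
  simpa using h2

theorem eq_of_biprod_components [HasBinaryBiproducts C] {Z Z' A : C} {δ δ' : E.Ext (Z ⊞ Z') A}
    (h : E.pull biprod.inl δ = E.pull biprod.inl δ')
    (h' : E.pull biprod.inr δ = E.pull biprod.inr δ') :
    δ = δ' := by
  rw [← E.pull_id δ, ← E.pull_id δ', ← biprod.total, E.pull_add, E.pull_add, ← E.pull_pull,
    ← E.pull_pull, ← E.pull_pull, ← E.pull_pull, h, h']

end ExtBifunctor

/-! ### Exactness of `𝔰`-triangles, by comparison with split triangles -/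

namespace Extriangulated

open scoped ZeroObject

variable {k : Type w} [CommRing k] {C : Type u} [Category.{v} C] [Preadditive C] [Linear k C]
  [HasZeroObject C] [HasBinaryBiproducts C] (E : Extriangulated.{e} k C)

theorem exists_realizes {Z A : C} (δ : E.Ext Z A) :
    ∃ (B : C) (x : A ⟶ B) (y : B ⟶ Z), E.Realizes x y δ := by
  obtain ⟨⟨B, x, y⟩, h⟩ := Quotient.exists_rep (E.s δ)
  exact ⟨B, x, y, h.symm⟩

variable {E}

namespace Realizes

variable {A B Z : C} {x : A ⟶ B} {y : B ⟶ Z} {δ : E.Ext Z A}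

theorem comp_eq_zero (h : E.Realizes x y δ) : x ≫ y = 0 := by
  obtain ⟨b, h1, h2⟩ := E.realization (0 : E.Ext 0 A) δ _ _ x y (E.s_zero 0 A) h (𝟙 A) 0 (by simp)
  rw [Category.id_comp] at h1
  rw [← h1, Category.assoc, ← h2]
  simp

theorem exists_lift (h : E.Realizes x y δ) {T : C} (t : T ⟶ Z) (ht : E.pull t δ = 0) :
    FactorsThrough t y := by
  obtain ⟨b, -, h2⟩ := E.realization (0 : E.Ext T 0) δ _ _ x y (E.s_zero T 0) h 0 t (by simp [ht])
  exact ⟨biprod.inr ≫ b, by rw [Category.assoc, ← h2, biprod.inr_snd_assoc]⟩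

theorem pull_right (h : E.Realizes x y δ) : E.pull y δ = 0 := by
  obtain ⟨a, h1, -⟩ := E.et3_op (0 : E.Ext B 0) δ _ _ x y (E.s_zero B 0) h biprod.snd y rfl
  rw [← h1, map_zero]

theorem factorsThrough_iff (h : E.Realizes x y δ) {T : C} (t : T ⟶ Z) :
    FactorsThrough t y ↔ E.pull t δ = 0 := by
  refine ⟨?_, h.exists_lift t⟩
  rintro ⟨s, rfl⟩
  rw [← E.pull_pull, h.pull_right, map_zero]

theorem exists_extend (h : E.Realizes x y δ) {T : C} (t : A ⟶ T) (ht : E.push t δ = 0) :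
    ∃ q : B ⟶ T, x ≫ q = t := by
  obtain ⟨b, h1, -⟩ := E.realization δ (0 : E.Ext 0 T) x y _ _ h (E.s_zero 0 T) t 0 (by simp [ht])
  exact ⟨b ≫ biprod.fst, by rw [← Category.assoc, h1, Category.assoc, biprod.inl_fst,
    Category.comp_id]⟩

theorem push_left (h : E.Realizes x y δ) : E.push x δ = 0 := by
  obtain ⟨c, h1, -⟩ := E.et3 δ (0 : E.Ext 0 B) x y _ _ h (E.s_zero 0 B) x biprod.inl rfl
  rw [h1, map_zero]

theorem exists_desc (h : E.Realizes x y δ) {T : C} (t : B ⟶ T) (ht : x ≫ t = 0) :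
    ∃ q : Z ⟶ T, y ≫ q = t := by
  obtain ⟨c, -, h1⟩ := E.et3 δ (0 : E.Ext T 0) x y _ _ h (E.s_zero T 0) 0 (t ≫ biprod.inr)
    (by rw [← Category.assoc, ht]; simp)
  exact ⟨c, by rw [h1]; simp⟩

/-- Exactness at `𝔼(Z, A)`: a lift of `y'` through `y` completes to a morphism of triangles over the
identity of `Z`. The next lemma is the dual. -/
theorem exists_push_eq (h : E.Realizes x y δ) {A' B' : C} {x' : A' ⟶ B'} {y' : B' ⟶ Z}
    {δ' : E.Ext Z A'} (h' : E.Realizes x' y' δ') (hy : E.pull y' δ = 0) :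
    ∃ a : A' ⟶ A, E.push a δ' = δ := by
  obtain ⟨r, hr⟩ := h.exists_lift y' hy
  obtain ⟨a, ha, -⟩ := E.et3_op δ' δ x' y' x y h' h r (𝟙 Z) (by rw [Category.comp_id, hr])
  exact ⟨a, by rw [ha, E.pull_id]⟩

theorem exists_pull_eq (h : E.Realizes x y δ) {B' Z' : C} {x' : A ⟶ B'} {y' : B' ⟶ Z'}
    {δ' : E.Ext Z' A} (h' : E.Realizes x' y' δ') (hx : E.push x' δ = 0) :
    ∃ c : Z ⟶ Z', E.pull c δ' = δ := by
  obtain ⟨r, hr⟩ := h.exists_extend x' hx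
  obtain ⟨c, hc, -⟩ := E.et3 δ δ' x y x' y' h h' (𝟙 A) r (by rw [Category.id_comp, hr])
  exact ⟨c, by rw [← hc, E.push_id]⟩

theorem eq_zero_of_split_mono (h : E.Realizes x y δ) {r : B ⟶ A} (hr : IsIso (x ≫ r)) :
    δ = 0 := by
  apply E.eq_zero_of_push_eq_zero (x ≫ r)
  rw [← E.push_push, h.push_left, map_zero]

theorem eq_zero_of_split_epi (h : E.Realizes x y δ) {s : Z ⟶ B} (hs : IsIso (s ≫ y)) :
    δ = 0 := by
  apply E.eq_zero_of_pull_eq_zero (s ≫ y)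
  rw [← E.pull_pull, h.pull_right, map_zero]

/-- The difference `n - 1` kills `x`, hence factors through `y`, and it is killed by `y`; so its
square is zero and `2 - n` inverts `n`. -/
theorem isIso_of_comp_eq (h : E.Realizes x y δ) {n : B ⟶ B} (h1 : x ≫ n = x) (h2 : n ≫ y = y) :
    IsIso n := by
  obtain ⟨s, hs⟩ := h.exists_desc (n - 𝟙 B) (by rw [Preadditive.comp_sub, h1]; simp)
  have h0 : (n - 𝟙 B) ≫ (n - 𝟙 B) = 0 := by
    rw [← hs, hs, ← hs, ← Category.assoc, hs, Preadditive.sub_comp, h2, Category.id_comp,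
      sub_self, zero_comp]
  have h3 : n ≫ n = n + n - 𝟙 B := by
    rw [← sub_eq_zero, ← h0]
    simp only [Preadditive.comp_sub, Preadditive.sub_comp, Category.id_comp, Category.comp_id]
    abel
  refine ⟨𝟙 B + 𝟙 B - n, ?_, ?_⟩
  · rw [Preadditive.comp_sub, Preadditive.comp_add, Category.comp_id, h3]
    abel
  · rw [Preadditive.sub_comp, Preadditive.add_comp, Category.id_comp, h3]
    abel

/-- A deflation `y` realizing `δ` is right minimal as soon as the stabilizer of `δ` consists of
automorphisms. -/
theorem isRightMinimal (h : E.Realizes x y δ)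
    (hδ : ∀ a : A ⟶ A, E.push a δ = δ → IsIso a) : IsRightMinimal y := by
  intro g hg
  obtain ⟨a, ha, hag⟩ := E.et3_op δ δ x y x y h h g (𝟙 Z) (by rw [hg, Category.comp_id])
  rw [E.pull_id] at ha
  have := hδ a ha
  have ha' : E.push (inv a) δ = E.pull (𝟙 Z) δ := by
    conv_lhs => rw [← ha]
    simp
  obtain ⟨g', hg', hg2⟩ := E.realization δ δ x y x y h h (inv a) (𝟙 Z) ha'
  rw [Category.comp_id] at hg2
  -- The lift `g'` of `a⁻¹` need not invert `g`, but both composites fix `x` and `y`.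
  have h1 : IsIso (g ≫ g') := h.isIso_of_comp_eq
    (by rw [← Category.assoc, hag, Category.assoc, hg', IsIso.hom_inv_id_assoc])
    (by rw [Category.assoc, ← hg2, hg])
  have h2 : IsIso (g' ≫ g) := h.isIso_of_comp_eq
    (by rw [← Category.assoc, hg', Category.assoc, hag, IsIso.inv_hom_id_assoc])
    (by rw [Category.assoc, hg, ← hg2])
  have e1 : IsSplitMono g := IsSplitMono.mk' ⟨g' ≫ inv (g ≫ g'), by
    rw [← Category.assoc, IsIso.hom_inv_id]⟩
  have e2 : Epi g := epi_of_epi g' g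
  exact isIso_of_epi_of_isSplitMono g

end Realizes

end Extriangulated

namespace Extriangulated

variable {k : Type w} [CommRing k] {C : Type u} [Category.{v} C] [Preadditive C] [Linear k C]
  [HasZeroObject C] [HasBinaryBiproducts C] (E : Extriangulated.{e} k C)

/-! ### Representing `D 𝔼(-, K)` -/

/-- The functional `γ` on `𝔼(W, K)` induces pairings `(f, η) ↦ γ (f^* η)` which are nondegenerate
on the stable category. -/
def IsDualizing {W K : C} (γ : MatlisDual k (E.Ext W K)) : Prop :=
  (∀ (M : C) (f : W ⟶ M), (∀ η : E.Ext M K, γ (E.pull f η) = 0) → f ∈ E.projMorphisms W M) ∧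
    ∀ (M : C) (η : E.Ext M K), (∀ f : W ⟶ M, γ (E.pull f η) = 0) → η = 0

/-- The map `(C / 𝒫)(W, M) → D 𝔼(M, K)` induced by a functional on `𝔼(W, K)`. -/
noncomputable def stableHomToDual {W K : C} (γ : MatlisDual k (E.Ext W K)) (M : C) :
    E.StableHom W M →ₗ[k] MatlisDual k (E.Ext M K) :=
  (E.projMorphisms W M).liftQ
    { toFun := fun f => γ ∘ₗ E.pull f
      map_add' := fun f g => LinearMap.ext fun η => by
        simp only [LinearMap.comp_apply, LinearMap.add_apply, E.pull_add, map_add]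
      map_smul' := fun r f => LinearMap.ext fun η => by
        simp only [LinearMap.comp_apply, LinearMap.smul_apply, E.pull_smul, map_smul,
          RingHom.id_apply] }
    (fun f hf => LinearMap.ext fun η => by
      change γ (E.pull f η) = 0
      rw [hf K η, map_zero])

theorem stableHomToDual_mk {W K : C} (γ : MatlisDual k (E.Ext W K)) {M : C} (f : W ⟶ M) :
    E.stableHomToDual γ M (Submodule.Quotient.mk f) = γ ∘ₗ E.pull f := rfl

variable {E}

/-- Nondegeneracy on the left is injectivity; on the right it says that the image separates the
points of the finitely generated module `𝔼(M, K)`, hence is the whole dual. -/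
theorem IsDualizing.memCl [IsArtinianRing k] (hfin : E.IsExtFinite) {W K : C}
    {γ : MatlisDual k (E.Ext W K)} (hγ : E.IsDualizing γ) : E.MemCl K := by
  refine ⟨W, fun M => LinearEquiv.ofBijective (E.stableHomToDual γ M) ⟨?_, ?_⟩, ?_⟩
  · rw [injective_iff_map_eq_zero]
    intro f hf
    obtain ⟨f, rfl⟩ := Submodule.Quotient.mk_surjective _ f
    rw [stableHomToDual_mk] at hf
    exact (Submodule.Quotient.mk_eq_zero _).2 (hγ.1 M f fun η => LinearMap.congr_fun hf η)
  · have := hfin M K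
    rw [← LinearMap.range_eq_top]
    refine MatlisDual.eq_top_of_separatesPoints _ fun η hη => hγ.2 M η fun f => ?_
    exact hη _ ⟨Submodule.Quotient.mk f, rfl⟩
  · intro M N f g
    obtain ⟨g, rfl⟩ := Submodule.Quotient.mk_surjective _ g
    refine LinearMap.ext fun η => ?_
    change γ (E.pull (g ≫ f) η) = γ (E.pull g (E.pull f η))
    rw [E.pull_pull]

/-- If `D 𝔼(-, K)` is represented by `W`, then morphisms from `W` detect extensions by `K`. -/
theorem MemCl.exists_detects [IsArtinianRing k] {K : C} (hK : E.MemCl K) :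
    ∃ W : C, ∀ (M : C) (η : E.Ext M K), (∀ f : W ⟶ M, E.pull f η = 0) → η = 0 := by
  obtain ⟨W, φ, hφ⟩ := hK
  refine ⟨W, fun M η hη => ?_⟩
  by_contra h0
  obtain ⟨γ, hγ⟩ := MatlisDual.exists_apply_ne_zero (k := k) h0
  obtain ⟨f, hf⟩ := (φ M).surjective γ
  obtain ⟨f, rfl⟩ := Submodule.Quotient.mk_surjective _ f
  -- Yoneda: every functional on `𝔼(M, K)` has the form `η ↦ γ₀ (f^* η)`, where `γ₀` is the image of
  -- the identity of `W`.
  have h1 := hφ f (Submodule.Quotient.mk (𝟙 W))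
  have h2 : E.stableComp W f (Submodule.Quotient.mk (𝟙 W)) = Submodule.Quotient.mk f := by
    change Submodule.Quotient.mk (𝟙 W ≫ f) = _
    rw [Category.id_comp]
  rw [h2, hf] at h1
  apply hγ
  rw [h1, LinearMap.comp_apply, hη f, map_zero]

theorem isDualizing_zero {W K : C} (hW : IsZero W) (hK : IsZero K) :
    E.IsDualizing (0 : MatlisDual k (E.Ext W K)) := by
  refine ⟨fun M f _ => ?_, fun M η _ => ?_⟩
  · rw [hW.eq_of_src f 0]
    exact Submodule.zero_mem _
  · rw [← E.push_id η, hK.eq_of_src (𝟙 K) 0, E.push_zero_left]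

theorem IsDualizing.of_iso {W K K' : C} {γ : MatlisDual k (E.Ext W K)} (hγ : E.IsDualizing γ)
    (i : K ≅ K') : E.IsDualizing (γ ∘ₗ E.push i.inv) := by
  refine ⟨fun M f hf => hγ.1 M f fun η => ?_, fun M η hη => ?_⟩
  · have h := hf (E.push i.hom η)
    rwa [LinearMap.comp_apply, E.pull_push, E.push_push, i.hom_inv_id, E.push_id] at h
  · refine E.eq_zero_of_push_eq_zero i.inv (hγ.2 M _ fun f => ?_)
    rw [E.pull_push]
    exact hη f

/-- The functional vanishes on the off-diagonal blocks, so the pairing decouples. -/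
theorem IsDualizing.biprod {W W' K K' : C} {γ : MatlisDual k (E.Ext W K)}
    {γ' : MatlisDual k (E.Ext W' K')} (hγ : E.IsDualizing γ) (hγ' : E.IsDualizing γ') :
    E.IsDualizing (γ ∘ₗ E.pull biprod.inl ∘ₗ E.push biprod.fst +
      γ' ∘ₗ E.pull biprod.inr ∘ₗ E.push biprod.snd :
        MatlisDual k (E.Ext (W ⊞ W') (K ⊞ K'))) := by
  refine ⟨fun M f hf => ?_, fun M η hη => ?_⟩
  · have h1 : biprod.inl ≫ f ∈ E.projMorphisms W M := hγ.1 M _ fun η => by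
      simpa [E.pull_push] using hf (E.push biprod.inl η)
    have h2 : biprod.inr ≫ f ∈ E.projMorphisms W' M := hγ'.1 M _ fun η => by
      simpa [E.pull_push] using hf (E.push biprod.inr η)
    intro A δ
    refine E.eq_of_biprod_components ?_ ?_
    · rw [E.pull_pull, h1 A δ, map_zero]
    · rw [E.pull_pull, h2 A δ, map_zero]
  · have h1 : E.push biprod.fst η = 0 := hγ.2 M _ fun f => by
      simpa [E.pull_push] using hη (biprod.fst ≫ f)
    have h2 : E.push biprod.snd η = 0 := hγ'.2 M _ fun f => by
      simpa [E.pull_push] using hη (biprod.snd ≫ f)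
    rw [← E.push_id η, ← biprod.total, E.push_add, ← E.push_push, ← E.push_push, h1, h2, map_zero,
      map_zero, add_zero]

/-! ### Extensions generating simple functors -/

variable (E) in
/-- The extension `ρ` is non-zero and every non-zero `t^* ρ` generates it: the subfunctor of
`𝔼(-, K)` generated by `ρ` is simple. -/
def IsSimpleExt {W K : C} (ρ : E.Ext W K) : Prop :=
  ρ ≠ 0 ∧ ∀ (T : C) (t : T ⟶ W), E.pull t ρ ≠ 0 → ∃ h : W ⟶ T, E.pull (h ≫ t) ρ = ρ

variable (E) in
/-- The extension `θ` is determined by `D`: a morphism killing `θ` can be recognised on morphisms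
from `D`. -/
def IsDeterminedExt (D : C) {Y K : C} (θ : E.Ext Y K) : Prop :=
  ∀ (T : C) (g : T ⟶ Y), (∀ h : D ⟶ T, E.pull (h ≫ g) θ = 0) → E.pull g θ = 0

theorem IsSimpleExt.pull {W W' K : C} {ρ : E.Ext W K} (hρ : E.IsSimpleExt ρ) (c : W' ⟶ W)
    (hc : E.pull c ρ ≠ 0) : E.IsSimpleExt (E.pull c ρ) := by
  refine ⟨hc, fun T t ht => ?_⟩
  rw [E.pull_pull] at ht
  obtain ⟨h, hh⟩ := hρ.2 T (t ≫ c) ht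
  refine ⟨c ≫ h, ?_⟩
  conv_rhs => rw [← hh]
  simp only [ExtBifunctor.pull_pull, Category.assoc]

theorem Realizes.isDeterminedExt_iff {X Y K D : C} {x : K ⟶ X} {y : X ⟶ Y} {δ : E.Ext Y K}
    (h : E.Realizes x y δ) : IsRightDetermined D y ↔ E.IsDeterminedExt D δ := by
  simp only [IsRightDetermined, IsDeterminedExt, h.factorsThrough_iff]

/-- A non-zero determined extension yields an extension generating a simple functor. -/
theorem IsDeterminedExt.exists_isSimpleExt [IsArtinianRing k] (hfin : E.IsExtFinite) {D Y K : C}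
    {θ : E.Ext Y K} (hθ : E.IsDeterminedExt D θ) (h0 : θ ≠ 0) :
    ∃ ρ : E.Ext D K, E.IsSimpleExt ρ := by
  have := hfin D K
  -- The values at `D` of the subfunctors generated by the non-zero `g^* θ`; a minimal one exists
  -- because `𝔼(D, K)` is artinian.
  let S : Set (Submodule k (E.Ext D K)) := {N | ∃ g : D ⟶ Y, E.pull g θ ≠ 0 ∧
    N = LinearMap.range (E.pullHom D (E.pull g θ))}
  have hS : S.Nonempty := by
    by_contra hS
    refine h0 ?_
    rw [← E.pull_id θ]
    refine hθ Y (𝟙 Y) fun h => ?_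
    by_contra hh
    exact hS ⟨_, h ≫ 𝟙 Y, hh, rfl⟩
  obtain ⟨N, ⟨g, hg, rfl⟩, hmin⟩ := wellFounded_lt.has_min S hS
  refine ⟨E.pull g θ, hg, fun T t ht => ?_⟩
  -- Determinacy brings the non-zero `t^* g^* θ` back to `D`; there it generates the same submodule
  -- by minimality, hence recovers `g^* θ`.
  obtain ⟨h, hh⟩ : ∃ h : D ⟶ T, E.pull (h ≫ t ≫ g) θ ≠ 0 := by
    by_contra! hall
    rw [E.pull_pull] at ht
    exact ht (hθ T (t ≫ g) hall)
  have hle : LinearMap.range (E.pullHom D (E.pull (h ≫ t ≫ g) θ)) ≤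
      LinearMap.range (E.pullHom D (E.pull g θ)) := by
    rintro _ ⟨c, rfl⟩
    refine ⟨c ≫ h ≫ t, ?_⟩
    change E.pull _ (E.pull _ _) = E.pull _ (E.pull _ _)
    simp only [ExtBifunctor.pull_pull, Category.assoc]
  have heq := eq_of_le_of_not_lt hle (hmin _ ⟨h ≫ t ≫ g, hh, rfl⟩)
  have hmem : E.pull g θ ∈ LinearMap.range (E.pullHom D (E.pull g θ)) := ⟨𝟙 D, E.pull_id _⟩
  rw [← heq] at hmem
  obtain ⟨c, hc⟩ := hmem
  refine ⟨c ≫ h, ?_⟩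
  change E.pull c (E.pull _ _) = _ at hc
  simpa only [ExtBifunctor.pull_pull, Category.assoc] using hc

/-- A non-zero extension restricts non-trivially to some indecomposable summand of `W`, and non-zero
pullbacks of `ρ` inherit simplicity. -/
theorem IsSimpleExt.exists_isLocalRing (hKS : IsKrullSchmidt C) {W K : C} {ρ : E.Ext W K}
    (hρ : E.IsSimpleExt ρ) :
    ∃ (W' : C) (ρ' : E.Ext W' K), IsLocalRing (End W') ∧ E.IsSimpleExt ρ' := by
  refine hKS.induction (fun W => ∀ ρ : E.Ext W K, E.IsSimpleExt ρ →
    ∃ (W' : C) (ρ' : E.Ext W' K), IsLocalRing (End W') ∧ E.IsSimpleExt ρ') ?_ ?_ ?_ ?_ W ρ hρ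
  · intro X Y i h ρ hρ
    exact h _ (hρ.pull i.hom fun h0 => hρ.1 (E.eq_zero_of_pull_eq_zero i.hom h0))
  · intro X hX ρ hρ
    exact absurd (by rw [← E.pull_id ρ, hX.eq_of_src (𝟙 X) 0, E.pull_zero_left]) hρ.1
  · intro X Y hX hY ρ hρ
    by_cases h1 : E.pull biprod.inl ρ = 0
    · refine hY _ (hρ.pull biprod.inr fun h2 => hρ.1 (E.eq_of_biprod_components ?_ ?_))
      · rw [h1, map_zero]
      · rw [h2, map_zero]
    · exact hX _ (hρ.pull biprod.inl h1)
  · intro X hX ρ hρ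
    exact ⟨X, ρ, hX, hρ⟩

/-- Every morphism from `K` not killing an extension which generates a simple functor is a split
monomorphism. -/
theorem IsSimpleExt.exists_isIso_comp {W K : C} (hK : IsLocalRing (End K)) {ρ : E.Ext W K}
    (hρ : E.IsSimpleExt ρ) {A : C} (a : K ⟶ A) (ha : E.push a ρ ≠ 0) :
    ∃ b : A ⟶ K, IsIso (a ≫ b) := by
  obtain ⟨X, x, y, h⟩ := E.exists_realizes ρ
  obtain ⟨X', x', y', h'⟩ := E.exists_realizes (E.push a ρ)
  -- Otherwise `ρ` is a pullback of `y'^* ρ`, and `a_* ρ` is one of `y'^* a_* ρ = 0`.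
  have h0 : E.pull y' ρ = 0 := by
    by_contra hne
    obtain ⟨t, ht⟩ := hρ.2 _ y' hne
    refine ha ?_
    rw [← ht, ← E.pull_push, ← E.pull_pull, h'.pull_right, map_zero]
  obtain ⟨b, hb⟩ := h.exists_push_eq h' h0
  refine ⟨b, (isIso_or_isIso_id_sub hK (a ≫ b)).resolve_right fun hiso => hρ.1 ?_⟩
  refine E.eq_zero_of_push_eq_zero (𝟙 K - a ≫ b) ?_
  rw [E.push_sub, E.push_id, ← E.push_push, hb, sub_self]

/-- An extension of objects with local endomorphism rings which generates a simple functor is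
almost split; any functional not vanishing on it is dualizing. -/
theorem IsSimpleExt.isDualizing {W K : C} (hW : IsLocalRing (End W)) (hK : IsLocalRing (End K))
    {ρ : E.Ext W K} (hρ : E.IsSimpleExt ρ) (γ : MatlisDual k (E.Ext W K)) (hγ : γ ρ ≠ 0) :
    E.IsDualizing γ := by
  obtain ⟨X, x, y, h⟩ := E.exists_realizes ρ
  refine ⟨fun M f hf A κ => ?_, fun M η hη => ?_⟩
  · by_contra hne
    obtain ⟨B, i, q, hq⟩ := E.exists_realizes (E.pull f κ)
    -- As `f^* κ ≠ 0`, its deflation `q` is not a split epimorphism, so it kills `ρ`. Hence `ρ = a_*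
    -- f^* κ = f^* a_* κ`, on which `γ` vanishes.
    have h0 : E.pull q ρ = 0 := by
      by_contra hq0
      obtain ⟨s, hs⟩ := hρ.2 _ q hq0
      rcases isIso_or_isIso_id_sub hW (s ≫ q) with hiso | hiso
      · exact hne (hq.eq_zero_of_split_epi hiso)
      · refine hρ.1 (E.eq_zero_of_pull_eq_zero (𝟙 W - s ≫ q) ?_)
        rw [E.pull_sub, E.pull_id, hs, sub_self]
    obtain ⟨a, ha⟩ := h.exists_push_eq hq h0
    refine hγ ?_
    rw [← ha, ← E.pull_push]
    exact hf _
  · by_contra hne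
    obtain ⟨N, i, q, hq⟩ := E.exists_realizes η
    -- Dually, the inflation `i` of `η ≠ 0` is not a split monomorphism, so it kills `ρ`, and `ρ =
    -- f^* η`.
    have h0 : E.push i ρ = 0 := by
      by_contra hi
      obtain ⟨b, hb⟩ := hρ.exists_isIso_comp hK i hi
      exact hne (hq.eq_zero_of_split_mono hb)
    obtain ⟨f, hf⟩ := h.exists_pull_eq hq h0
    exact hγ (hf ▸ hη f)

/-! ### Intrinsic weak kernels of determined deflations -/

/-- If a right minimal deflation with kernel `K` is determined by `D`, then each non-zero retract of
`K` admits a non-zero extension determined by `D`. -/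
theorem Realizes.exists_isDeterminedExt_retract {X Y K K' D : C} {x : K ⟶ X} {y : X ⟶ Y}
    {δ : E.Ext Y K} (h : E.Realizes x y δ) (hmin : IsRightMinimal y) (hδ : E.IsDeterminedExt D δ)
    (j : K' ⟶ K) (p : K ⟶ K') (hjp : j ≫ p = 𝟙 K') (hK' : 𝟙 K' ≠ 0) :
    ∃ (Y' : C) (θ : E.Ext Y' K'), θ ≠ 0 ∧ E.IsDeterminedExt D θ := by
  -- Pulling back along `y'` kills the part of `δ` complementary to `K'`, so `y'^* δ` comes from `θ
  -- = p_* y'^* δ` via `j`.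
  obtain ⟨X', x', y', h'⟩ := E.exists_realizes (E.push (𝟙 K - p ≫ j) δ)
  have hdecomp : E.push j (E.push p (E.pull y' δ)) = E.pull y' δ := by
    have h1 := h'.pull_right
    rw [E.pull_push, E.push_sub, E.push_id, sub_eq_zero] at h1
    rw [E.push_push, ← h1]
  refine ⟨X', E.push p (E.pull y' δ), fun h0 => ?_, fun T g hg => ?_⟩
  · rw [h0, map_zero] at hdecomp
    obtain ⟨a, ha⟩ := h.exists_push_eq h' hdecomp.symm
    rw [E.push_push] at ha
    -- If `θ = 0`, then `δ = a_* (1 - p ≫ j)_* δ`, and the extension `q` makes `j ≫ x` a split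
    -- monomorphism into `X` killed by `y`. Removing this summand by `1 - q ≫ j ≫ x` contradicts
    -- minimality.
    obtain ⟨q, hq⟩ := h.exists_extend ((𝟙 K - (𝟙 K - p ≫ j) ≫ a) ≫ p) (by
      rw [← E.push_push, E.push_sub, E.push_id, ha, sub_self, map_zero])
    have hq' : j ≫ x ≫ q = 𝟙 K' := by
      rw [hq, ← Category.assoc, Preadditive.comp_sub, ← Category.assoc, Preadditive.comp_sub,
        ← Category.assoc, hjp]
      simp [hjp]
    have hiso := hmin (𝟙 X - q ≫ j ≫ x) (by
      rw [Preadditive.sub_comp, Category.assoc, Category.assoc, h.comp_eq_zero]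
      simp)
    have hz : (j ≫ x) ≫ (𝟙 X - q ≫ j ≫ x) = 0 := by
      rw [Preadditive.comp_sub, ← Category.assoc, Category.assoc j x q, hq']
      simp
    have hjx : j ≫ x = 0 := by
      rw [← cancel_mono (𝟙 X - q ≫ j ≫ x), hz, zero_comp]
    apply hK'
    rw [← hq', ← Category.assoc, hjx, zero_comp]
  · have hz : E.pull (g ≫ y') δ = 0 := hδ T _ fun t => by
      have h1 := congrArg (E.push j) (hg t)
      rwa [← E.pull_push (t ≫ g) j, hdecomp, E.pull_pull, map_zero, Category.assoc] at h1
    rw [E.pull_push, E.pull_pull, hz, map_zero]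

/-- It suffices to find a dualizing functional for each indecomposable summand of `K`, since these
pass to direct sums. -/
theorem memCl_of_isRightDetermined [IsArtinianRing k] (hKS : IsKrullSchmidt C)
    (hfin : E.IsExtFinite) {X Y K D : C} {x : K ⟶ X} {y : X ⟶ Y} {δ : E.Ext Y K}
    (h : E.Realizes x y δ) (hmin : IsRightMinimal y) (hD : IsRightDetermined D y) :
    E.MemCl K := by
  obtain ⟨n, f, b, ⟨hb⟩, ⟨i⟩, hf⟩ := hKS K
  suffices hdual : ∃ (W : C) (γ : MatlisDual k (E.Ext W b.pt)), E.IsDualizing γ by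
    obtain ⟨W, γ, hγ⟩ := hdual
    exact (hγ.of_iso i.symm).memCl hfin
  refine hb.induction_biprod
    (fun K => ∃ (W : C) (γ : MatlisDual k (E.Ext W K)), E.IsDualizing γ) ?_ ?_ ?_ ?_
  · rintro X Y i ⟨W, γ, hγ⟩
    exact ⟨W, _, hγ.of_iso i⟩
  · intro X hX
    exact ⟨X, 0, isDualizing_zero hX hX⟩
  · rintro X Y ⟨W, γ, hγ⟩ ⟨W', γ', hγ'⟩
    exact ⟨_, _, hγ.biprod hγ'⟩
  · intro l
    obtain ⟨Y', θ, hθ0, hθ⟩ := h.exists_isDeterminedExt_retract hmin (h.isDeterminedExt_iff.1 hD)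
      (b.ι l ≫ i.inv) (i.hom ≫ b.π l) (by simp) (id_ne_zero_of_isLocalRing_end (hf l))
    obtain ⟨ρ, hρ⟩ := hθ.exists_isSimpleExt hfin hθ0
    obtain ⟨W, ρ', hW, hρ'⟩ := hρ.exists_isLocalRing hKS
    obtain ⟨γ, hγ⟩ := MatlisDual.exists_apply_ne_zero (k := k) hρ'.1
    exact ⟨W, γ, hρ'.isDualizing hW (hf l) γ hγ⟩

/-! ### Extensions with small stabilizer -/

theorem HasNoInjectiveSummand.of_retract {X Y Z : C} (h : E.HasNoInjectiveSummand Z)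
    (i : Z ≅ X ⊞ Y) : E.HasNoInjectiveSummand X := by
  rintro S S' ⟨j⟩ hS
  exact h S (S' ⊞ Y) ⟨i ≪≫ biprod.mapIso j (Iso.refl Y) ≪≫ biprod.associator S S' Y⟩ hS

open scoped ZeroObject in
/-- An object `K` without non-zero injective summands admits an extension `δ` all of whose
stabilizing endomorphisms are automorphisms. -/
theorem HasNoInjectiveSummand.exists_stabilizer_isIso (hKS : IsKrullSchmidt C) {K : C}
    (hK : E.HasNoInjectiveSummand K) :
    ∃ (Y : C) (δ : E.Ext Y K), ∀ a : K ⟶ K, E.push a δ = δ → IsIso a := by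
  revert hK
  refine hKS.induction (fun K => E.HasNoInjectiveSummand K →
    ∃ (Y : C) (δ : E.Ext Y K), ∀ a : K ⟶ K, E.push a δ = δ → IsIso a) ?_ ?_ ?_ ?_ K
  · intro X X' i h hX'
    obtain ⟨Y, δ, hδ⟩ := h fun S S' ⟨j⟩ hS => hX' S S' ⟨i.symm ≪≫ j⟩ hS
    refine ⟨Y, E.push i.hom δ, fun a ha => ?_⟩
    have h1 : IsIso (i.hom ≫ a ≫ i.inv) := hδ _ (by
      rw [← Category.assoc, ← E.push_push, ← E.push_push, ha, E.push_push, i.hom_inv_id, E.push_id])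
    have h2 : a = i.inv ≫ (i.hom ≫ a ≫ i.inv) ≫ i.hom := by simp
    rw [h2]
    infer_instance
  · intro X hX _
    exact ⟨X, 0, fun a _ => by
      rw [hX.eq_of_src a (𝟙 X)]
      infer_instance⟩
  · intro X X' hX hX' hsum
    obtain ⟨Y, δ, hδ⟩ := hX (hsum.of_retract (Iso.refl _))
    obtain ⟨Y', δ', hδ'⟩ := hX' (hsum.of_retract (biprod.braiding X X'))
    refine ⟨Y ⊞ Y', E.sum δ δ', fun a ha => ?_⟩
    rw [← Biprod.ofComponents_eq a]
    have e11 : E.push (biprod.inl ≫ a ≫ biprod.fst) δ = δ := by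
      have := congrArg (fun t => E.pull biprod.inl (E.push biprod.fst t)) ha
      simpa [ExtBifunctor.sum, E.pull_push] using this
    have e12 : E.push (biprod.inl ≫ a ≫ biprod.snd) δ = 0 := by
      have := congrArg (fun t => E.pull biprod.inl (E.push biprod.snd t)) ha
      simpa [ExtBifunctor.sum, E.pull_push] using this
    have e21 : E.push (biprod.inr ≫ a ≫ biprod.fst) δ' = 0 := by
      have := congrArg (fun t => E.pull biprod.inr (E.push biprod.fst t)) ha
      simpa [ExtBifunctor.sum, E.pull_push] using this
    have e22 : E.push (biprod.inr ≫ a ≫ biprod.snd) δ' = δ' := by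
      have := congrArg (fun t => E.pull biprod.inr (E.push biprod.snd t)) ha
      simpa [ExtBifunctor.sum, E.pull_push] using this
    have := hδ _ e11
    -- The entry `X' ⟶ X` kills `δ'`, so the Schur complement still fixes `δ'`.
    refine isIso_biprod_ofComponents_of_schur _ _ _ _ (hδ' _ ?_)
    rw [E.push_sub, e22, ← E.push_push, e21, map_zero, sub_zero]
  · intro X hX hno
    -- `X` is a non-zero summand of itself, hence not injective. If `a` fixes `δ ≠ 0`, then `1 - a`
    -- kills it and cannot be invertible.
    obtain ⟨Y, δ, hδ⟩ : ∃ (Y : C) (δ : E.Ext Y X), δ ≠ 0 := by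
      by_contra! hall
      refine id_ne_zero_of_isLocalRing_end hX ((IsZero.iff_id_eq_zero X).1 ?_)
      exact hno X 0 ⟨(isoBiprodZero (isZero_zero C))⟩ fun Z δ => by rw [E.push_id, hall Z δ]
    refine ⟨Y, δ, fun a ha => (isIso_or_isIso_id_sub hX a).resolve_right fun hiso => hδ ?_⟩
    refine E.eq_zero_of_push_eq_zero (𝟙 X - a) ?_
    rw [E.push_sub, E.push_id, ha, sub_self]

end Extriangulated

/-- Determinacy depends only on which morphisms factor through `f`, and right equivalent morphisms
agree on this. -/
theorem IsRightDetermined.of_factorsThrough {C : Type u} [Category.{v} C] {D X X' Y : C}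
    {f : X ⟶ Y} {f' : X' ⟶ Y} (hf : IsRightDetermined D f) (h : FactorsThrough f f')
    (h' : FactorsThrough f' f) : IsRightDetermined D f' := by
  have htrans : ∀ {A B T : C} {a : A ⟶ Y} {b : B ⟶ Y} {g : T ⟶ Y}, FactorsThrough a b →
      FactorsThrough g a → FactorsThrough g b := by
    rintro A B T a b g ⟨s, rfl⟩ ⟨t, rfl⟩
    exact ⟨t ≫ s, Category.assoc _ _ _⟩
  exact fun T g hg => htrans h (hf T g fun t => htrans h' (hg t))

theorem proposition4p9 {k : Type w} [CommRing k] [IsArtinianRing k]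
    {C : Type u} [Category.{v} C] [Preadditive C] [Linear k C]
    [HasZeroObject C] [HasBinaryBiproducts C]
    (E : Extriangulated.{e} k C) (hKS : IsKrullSchmidt C) (hfin : E.IsExtFinite) (hWIC : E.WIC)
    (K : C) (hK : E.HasNoInjectiveSummand K) :
    E.MemCl K ↔
      ∃ (X Y : C) (α : X ⟶ Y), E.IsDeflation α ∧ (∃ D : C, IsRightDetermined D α) ∧
        E.IsIntrinsicWeakKernel K α := by
  constructor
  · intro hCl
    obtain ⟨W, hW⟩ := hCl.exists_detects
    obtain ⟨Y, δ, hδ⟩ := hK.exists_stabilizer_isIso hKS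
    obtain ⟨X, x, y, h⟩ := E.exists_realizes δ
    refine ⟨X, Y, y, ⟨K, x, δ, h⟩, ⟨W, h.isDeterminedExt_iff.2 fun T g hg => hW T _ fun t => ?_⟩,
      ⟨K, x, δ, h⟩, X, y, ⟨h.isRightMinimal hδ, ?_, ?_⟩, x, δ, h⟩
    · rw [E.pull_pull, hg t]
    · exact ⟨𝟙 X, Category.id_comp y⟩
    · exact ⟨𝟙 X, Category.id_comp y⟩
  · rintro ⟨X, Y, α, -, ⟨D, hD⟩, -, X', α', ⟨hmin, h1, h2⟩, x, δ, h⟩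
    exact Extriangulated.memCl_of_isRightDetermined hKS hfin h hmin (hD.of_factorsThrough h1 h2)
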